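/- **Definitions.** A *Smale space* $(X,\varphi)$ is a compact metric space $(X,d)$ with a homeomorphism $\varphi:X\to X$ for which there are constants $\varepsilon_X>0$, $0<\lambda<1$ and a continuous map $(x,y)\mapsto[x,y]\in X$, defined for $d(x,y)\le\varepsilon_X$, such that $$[x,x]=x,\quad [x,[y,z]]=[x,z],\quad [[x,y],z]=[x,z],\quad \varphi[x,y]=[\varphi(x),\varphi(y)]$$ whenever both sides are defined, and such that, for $d(y,z)\le\varepsilon_X$, $d(\varphi(y),\varphi(z))\le\lambda d(y,z)$ if $[y,z]=z$, and $d(\varphi^{-1}(y),\varphi^{-1}(z))\le\lambda d(y,z)$ if $[y,z]=y$. It is *irreducible* if for every ordered pair of non-empty open sets $U,V\subseteq X$ there is an integer $N\geq 1$ with $\varphi^N(U)\cap V\ne\varnothing$. Put $$X^s(x)=\{y: \lim_{n\to+\infty} d(\varphi^n(x),\varphi^n(y))=0\},\qquad X^u(x)=\{y: \lim_{n\to+\infty} d(\varphi^{-n}(x),\varphi^{-n}(y))=0\}.$$ A *factor map* $\pi:(Y,\psi)\to(X,\varphi)$ is a continuous surjection $\pi:Y\to X$ with $\pi\circ\psi=\varphi\circ\pi$.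 It is *s-bijective* (resp. *u-bijective*) if for every $y\in Y$ it restricts to a bijection $Y^s(y)\to X^s(\pi(y))$ (resp. $Y^u(y)\to X^u(\pi(y))$). A *conjugacy* is a homeomorphism intertwining the dynamics. **Theorem.** Let $(X,\varphi)$, $(X_1,\varphi_1)$, $(X_2,\varphi_2)$, $(X_0,\varphi_0)$ be irreducible Smale spaces, let $\eta_1:(X,\varphi)\to(X_1,\varphi_1)$ and $\pi_2:(X_2,\varphi_2)\to(X_0,\varphi_0)$ be s-bijective factor maps, and let $\eta_2:(X,\varphi)\to(X_2,\varphi_2)$ and $\pi_1:(X_1,\varphi_1)\to(X_0,\varphi_0)$ be u-bijective factor maps, such that $\pi_1\circ\eta_1=\pi_2\circ\eta_2$. Let $$F=\{(x_2,x_1)\in X_2\times X_1:\pi_2(x_2)=\pi_1(x_1)\}$$ be the fibre product, with the subspace topology and the homeomorphism $\varphi_2\times\varphi_1$. Suppose that $\eta_2\times\eta_1:X\to F$, $x\mapsto(\eta_2(x),\eta_1(x))$, is onto, and that for $i=1$ or $i=2$ there is $z\in X_i$ such that $\eta_i^{-1}\{z\}$ consists of a single element. Then $\eta_2\times\eta_1:(X,\varphi)\to(F,\varphi_2\times\varphi_1)$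 is a conjugacy. -/

import Mathlib

open Filter Topology

namespace SmaleSpace

/-- `φ` makes the compact metric space `X` a Smale space. The bracket is only meaningful on pairs
at distance at most `ε`: continuity and each axiom are required only where all the brackets that
occur are defined, so its values elsewhere are irrelevant. -/
def IsSmaleSpace {X : Type*} [MetricSpace X] [CompactSpace X] (φ : X ≃ₜ X) : Prop :=
  ∃ (ε lam : ℝ) (br : X → X → X),
    0 < ε ∧ 0 < lam ∧ lam < 1 ∧
    ContinuousOn (fun p : X × X => br p.1 p.2) {p : X × X | dist p.1 p.2 ≤ ε} ∧
    -- (B1)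
    (∀ x, br x x = x) ∧
    -- (B2)
    (∀ x y z, dist y z ≤ ε → dist x (br y z) ≤ ε → dist x z ≤ ε →
      br x (br y z) = br x z) ∧
    -- (B3)
    (∀ x y z, dist x y ≤ ε → dist (br x y) z ≤ ε → dist x z ≤ ε →
      br (br x y) z = br x z) ∧
    -- (B4)
    (∀ x y, dist x y ≤ ε → dist (φ x) (φ y) ≤ ε → φ (br x y) = br (φ x) (φ y)) ∧
    -- (C1)
    (∀ y z, dist y z ≤ ε → br y z = z → dist (φ y) (φ z) ≤ lam * dist y z) ∧
    -- (C2)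
    (∀ y z, dist y z ≤ ε → br y z = y → dist (φ.symm y) (φ.symm z) ≤ lam * dist y z)

/-- Irreducibility: for every ordered pair of nonempty open sets `U`, `V` there is a positive
integer `N` such that `φ^N(U)` meets `V`. -/
def IsIrreducible {X : Type*} [TopologicalSpace X] (φ : X ≃ₜ X) : Prop :=
  ∀ U V : Set X, IsOpen U → IsOpen V → U.Nonempty → V.Nonempty →
    ∃ N : ℕ, 0 < N ∧ ((φ^[N] '' U) ∩ V).Nonempty

/-- The global stable set of `x`. -/
def stableSet {X : Type*} [MetricSpace X] (φ : X ≃ₜ X) (x : X) : Set X :=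
  {y | Tendsto (fun n : ℕ => dist (φ^[n] x) (φ^[n] y)) atTop (𝓝 0)}

/-- The global unstable set of `x`. -/
def unstableSet {X : Type*} [MetricSpace X] (φ : X ≃ₜ X) (x : X) : Set X :=
  {y | Tendsto (fun n : ℕ => dist (φ.symm^[n] x) (φ.symm^[n] y)) atTop (𝓝 0)}

/-- A factor map `(Y, ψ) → (X, φ)`: a continuous surjection intertwining the dynamics. -/
def IsFactorMap {Y X : Type*} [TopologicalSpace Y] [TopologicalSpace X]
    (ψ : Y ≃ₜ Y) (φ : X ≃ₜ X) (f : Y → X) : Prop :=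
  Continuous f ∧ Function.Semiconj f ψ φ ∧ Function.Surjective f

/-- `f` restricts to a bijection `Y^s(y) → X^s(f y)` for every `y`. -/
def IsSBijective {Y X : Type*} [MetricSpace Y] [MetricSpace X]
    (ψ : Y ≃ₜ Y) (φ : X ≃ₜ X) (f : Y → X) : Prop :=
  ∀ y, Set.BijOn f (stableSet ψ y) (stableSet φ (f y))

/-- `f` restricts to a bijection `Y^u(y) → X^u(f y)` for every `y`. -/
def IsUBijective {Y X : Type*} [MetricSpace Y] [MetricSpace X]
    (ψ : Y ≃ₜ Y) (φ : X ≃ₜ X) (f : Y → X) : Prop :=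
  ∀ y, Set.BijOn f (unstableSet ψ y) (unstableSet φ (f y))

/-- A conjugacy: a homeomorphism intertwining the dynamics. -/
def IsConjugacy {Y X : Type*} [TopologicalSpace Y] [TopologicalSpace X]
    (ψ : Y ≃ₜ Y) (φ : X ≃ₜ X) (f : Y → X) : Prop :=
  IsHomeomorph f ∧ Function.Semiconj f ψ φ

/-- The fibre product of `f : A → C` and `g : B → C`, with the subspace topology of `A × B`. -/
abbrev FibreProduct {A B C : Type*} (f : A → C) (g : B → C) : Type _ :=
  {p : A × B // f p.1 = g p.2}

/-- The homeomorphism `(a, b) ↦ (α a, β b)` of the fibre product. -/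
def fibreProductHomeo {A B C : Type*} [TopologicalSpace A] [TopologicalSpace B]
    {f : A → C} {g : B → C} (α : A ≃ₜ A) (β : B ≃ₜ B) (γ : C ≃ C)
    (hf : Function.Semiconj f α γ) (hg : Function.Semiconj g β γ) :
    FibreProduct f g ≃ₜ FibreProduct f g :=
  (α.prodCongr β).subtype fun p => by
    change f p.1 = g p.2 ↔ f (α p.1) = g (β p.2)
    rw [hf.eq, hg.eq, γ.injective.eq_iff]

/-- The map `x ↦ (η₂ x, η₁ x)` into the fibre product, for a commuting square. -/
def toFibreProduct {X A B C : Type*} {f : A → C} {g : B → C} (η₂ : X → A) (η₁ : X → B)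
    (h : ∀ x, f (η₂ x) = g (η₁ x)) (x : X) : FibreProduct f g :=
  ⟨(η₂ x, η₁ x), h x⟩

end SmaleSpace

/-! The map `η₂ × η₁` is a continuous surjection from a compact space to a Hausdorff one, so only
injectivity is at stake. Let `D` be the set of points that share their image with another point.
Lifting along the s-bijective sides of the square shows that `D` is saturated under stable
equivalence (`mem_nonInjLocus_of_mem_stableSet`). Time reversal, with the two sides exchanged, gives
the unstable case. By local product structure such a `D` is clopen, and it is `φ`-invariant, so
irreducibility makes it empty or everything (`eq_empty_or_univ_of_saturated`). A one-point fibre of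
`η₁` or `η₂` gives a point outside `D`, hence `D` is empty. -/

namespace SmaleSpace

section Stable

variable {X Y : Type*} [MetricSpace X] [MetricSpace Y] {φ : X ≃ₜ X} {ψ : Y ≃ₜ Y}

theorem stableSet_symm {x y : X} (h : y ∈ stableSet φ x) : x ∈ stableSet φ y := by
  simpa only [stableSet, Set.mem_ofPred_eq, dist_comm] using h

theorem stableSet_trans {x y z : X} (hxy : y ∈ stableSet φ x) (hyz : z ∈ stableSet φ y) :
    z ∈ stableSet φ x := by
  have h := Tendsto.add hxy hyz
  rw [add_zero] at h
  exact squeeze_zero (fun _ => dist_nonneg) (fun _ => dist_triangle _ _ _) h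

theorem map_mem_stableSet [CompactSpace X] {f : X → Y} (hf : Continuous f)
    (hs : Function.Semiconj f φ ψ) {x y : X} (h : y ∈ stableSet φ x) :
    f y ∈ stableSet ψ (f x) := by
  have hu := CompactSpace.uniformContinuous_of_continuous hf
  have h' := Tendsto.comp hu (tendsto_uniformity_iff_dist_tendsto_zero
    (f := fun n : ℕ => (φ^[n] x, φ^[n] y)).2 h)
  have := tendsto_uniformity_iff_dist_tendsto_zero.1 h'
  simpa only [stableSet, Set.mem_ofPred_eq, ← (hs.iterate_right _).eq, Function.comp_def]
    using this

/-- The points at which the pair `(f, g)` fails to be injective. -/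
def nonInjLocus {X A B : Type*} (f : X → A) (g : X → B) : Set X :=
  {x | ∃ x', f x' = f x ∧ g x' = g x ∧ x' ≠ x}

theorem nonInjLocus_swap {X A B : Type*} (f : X → A) (g : X → B) :
    nonInjLocus f g = nonInjLocus g f := by
  ext x
  simp only [nonInjLocus, Set.mem_ofPred_eq, and_left_comm]

/-- In a commuting square whose maps `g` and `p` are s-bijective, the non-injectivity locus of
`(f, g)` is saturated under stable equivalence. -/
theorem mem_nonInjLocus_of_mem_stableSet {A B C : Type*} [MetricSpace A] [MetricSpace B]
    [MetricSpace C] [CompactSpace X] {α : A ≃ₜ A} {β : B ≃ₜ B} {γ : C ≃ₜ C}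
    {f : X → A} {g : X → B} {p : A → C} {q : B → C} (hf : Continuous f)
    (hs : Function.Semiconj f φ α) (hg : IsSBijective φ β g) (hp : IsSBijective α γ p)
    (hcomm : ∀ x, p (f x) = q (g x)) {x w : X} (hx : x ∈ nonInjLocus f g)
    (hw : w ∈ stableSet φ x) : w ∈ nonInjLocus f g := by
  obtain ⟨x', hfx, hgx, hne⟩ := hx
  -- The partner of `w` is the lift of `g w` through `g` to the stable set of `x'`.
  have hgw : g w ∈ stableSet β (g x') := hgx ▸ (hg x).mapsTo hw
  obtain ⟨w', hw', hgw'⟩ := (hg x').surjOn hgw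
  refine ⟨w', ?_, hgw', ?_⟩
  -- Both `f w'` and `f w` are stably equivalent to `f x = f x'`, where `p` is injective.
  · refine (hp (f x)).injOn (hfx ▸ map_mem_stableSet hf hs hw') (map_mem_stableSet hf hs hw) ?_
    rw [hcomm, hcomm, hgw']
  -- If the lift were `w` itself, `x` and `x'` would lie in one stable set, where `g` separates
  -- them.
  · rintro rfl
    exact hne ((hg w').injOn (stableSet_symm hw') (stableSet_symm hw) hgx)

end Stable

section LocalProduct

variable {X : Type*} [MetricSpace X]

/-- Keeping `R` abstract lets one induction serve (C1) for `φ` and (C2) for `φ.symm`. Contraction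
keeps the orbits within `ε`, so the local axiom applies at every step. -/
theorem mem_stableSet_of_contracting {φ : X ≃ₜ X} {ε lam : ℝ} {R : X → X → Prop} (h0 : 0 < lam)
    (h1 : lam < 1) (hc : ∀ y z, dist y z ≤ ε → R y z → dist (φ y) (φ z) ≤ lam * dist y z)
    (hR : ∀ y z, dist y z ≤ ε → dist (φ y) (φ z) ≤ ε → R y z → R (φ y) (φ z))
    {y z : X} (hd : dist y z ≤ ε) (hyz : R y z) : z ∈ stableSet φ y := by
  have key : ∀ n : ℕ, dist (φ^[n] y) (φ^[n] z) ≤ lam ^ n * dist y z ∧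
      dist (φ^[n] y) (φ^[n] z) ≤ ε ∧ R (φ^[n] y) (φ^[n] z) := by
    intro n
    induction n with
    | zero => simpa using ⟨hd, hyz⟩
    | succ n ih =>
      obtain ⟨ha, hb, hr⟩ := ih
      simp only [Function.iterate_succ_apply']
      have h := hc _ _ hb hr
      have hε : dist (φ (φ^[n] y)) (φ (φ^[n] z)) ≤ ε :=
        (h.trans (mul_le_of_le_one_left dist_nonneg h1.le)).trans hb
      refine ⟨h.trans ?_, hε, hR _ _ hb hε hr⟩
      rw [pow_succ', mul_assoc]
      exact mul_le_mul_of_nonneg_left ha h0.le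
  refine squeeze_zero (fun _ => dist_nonneg) (fun n => (key n).1) ?_
  simpa using (tendsto_pow_atTop_nhds_zero_of_lt_one h0.le h1).mul_const (dist y z)

/-- Nearby points of a Smale space are joined by a stable step followed by an unstable step. -/
theorem IsSmaleSpace.eventually_exists_bracket [CompactSpace X] {φ : X ≃ₜ X}
    (hX : IsSmaleSpace φ) (x : X) :
    ∀ᶠ y in 𝓝 x, ∃ p, p ∈ stableSet φ x ∧ p ∈ unstableSet φ y := by
  obtain ⟨ε, lam, br, hε, h0, h1, hcont, hB1, hB2, hB3, hB4, hC1, hC2⟩ := hX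
  have hxy : ∀ᶠ y in 𝓝 x, dist x y < ε := by
    filter_upwards [Metric.ball_mem_nhds x hε] with y hy
    rwa [dist_comm]
  -- Since `[x,x] = x`, the bracket `[x,y]` is close to both `x` and `y` once `y` is close to `x`.
  have hbr : Tendsto (fun y => br x y) (𝓝 x) (𝓝 x) := by
    have h := hcont (x, x) (by simpa using hε.le)
    have h' : Tendsto (fun y : X => (x, y)) (𝓝 x)
        (𝓝[{p : X × X | dist p.1 p.2 ≤ ε}] (x, x)) :=
      tendsto_nhdsWithin_iff.2 ⟨(Continuous.prodMk_right x).tendsto x, hxy.mono fun _ h => h.le⟩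
    simpa only [hB1, Function.comp_def] using h.tendsto.comp h'
  have hp1 := (tendsto_const_nhds (x := x)).dist hbr
  have hp2 := hbr.dist tendsto_id
  rw [dist_self] at hp1 hp2
  filter_upwards [hxy, hp1.eventually_lt_const hε, hp2.eventually_lt_const hε] with y hy h₁ h₂
  replace h₂ : dist (br x y) y < ε := h₂
  -- The unstable set of `φ` is by definition the stable set of `φ.symm`. The relations needed are
  -- `[x,[x,y]] = [x,y]` and `[[x,y],y] = [x,y]`.
  refine ⟨br x y, ?_, stableSet_symm (φ := φ.symm) ?_⟩
  · refine mem_stableSet_of_contracting (R := fun a b => br a b = b) h0 h1 hC1 ?_ h₁.le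
      (hB2 _ _ _ hy.le h₁.le hy.le)
    intro a b hab hab' h
    rw [← hB4 a b hab hab', h]
  · refine mem_stableSet_of_contracting (φ := φ.symm) (R := fun a b => br a b = a) h0 h1 hC2 ?_
      h₂.le (hB3 _ _ _ hy.le h₂.le hy.le)
    intro a b hab hab' h
    apply φ.injective
    rw [hB4 _ _ hab' (by simpa using hab)]
    simpa using h

/-- In an irreducible Smale space, an invariant set saturated under stable and unstable
equivalence is empty or everything. -/
theorem eq_empty_or_univ_of_saturated [CompactSpace X] {φ : X ≃ₜ X} (hX : IsSmaleSpace φ)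
    (iX : IsIrreducible φ) {D : Set X} (hφ : ∀ x ∈ D, φ x ∈ D)
    (hs : ∀ x ∈ D, ∀ y ∈ stableSet φ x, y ∈ D) (hu : ∀ x ∈ D, ∀ y ∈ unstableSet φ x, y ∈ D) :
    D = ∅ ∨ D = Set.univ := by
  have hopen : IsOpen D := by
    refine isOpen_iff_mem_nhds.2 fun x hx => ?_
    filter_upwards [hX.eventually_exists_bracket x] with y ⟨p, hp, hp'⟩
    exact hu p (hs x hx p hp) y (stableSet_symm (φ := φ.symm) hp')
  -- The same two steps taken backwards: a nearby `y ∈ D` would force `p`, then `x`, into `D`.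
  have hopen' : IsOpen Dᶜ := by
    refine isOpen_iff_mem_nhds.2 fun x hx => ?_
    filter_upwards [hX.eventually_exists_bracket x] with y ⟨p, hp, hp'⟩ hy
    exact hx (hs p (hu y hy p hp') x (stableSet_symm hp))
  by_contra! h
  obtain ⟨N, -, y, ⟨x, hx, rfl⟩, hy⟩ := iX D Dᶜ hopen hopen' h.1
    (Set.nonempty_compl.2 h.2)
  exact hy ((show Set.MapsTo φ D D from hφ).iterate N hx)

end LocalProduct

end SmaleSpace


theorem theorem3p4 {X X₁ X₂ X₀ : Type*}
    [MetricSpace X] [CompactSpace X] [MetricSpace X₁] [CompactSpace X₁]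
    [MetricSpace X₂] [CompactSpace X₂] [MetricSpace X₀] [CompactSpace X₀]
    (φ : X ≃ₜ X) (φ₁ : X₁ ≃ₜ X₁) (φ₂ : X₂ ≃ₜ X₂) (φ₀ : X₀ ≃ₜ X₀)
    (hX : SmaleSpace.IsSmaleSpace φ) (hX₁ : SmaleSpace.IsSmaleSpace φ₁)
    (hX₂ : SmaleSpace.IsSmaleSpace φ₂) (hX₀ : SmaleSpace.IsSmaleSpace φ₀)
    (iX : SmaleSpace.IsIrreducible φ) (iX₁ : SmaleSpace.IsIrreducible φ₁)
    (iX₂ : SmaleSpace.IsIrreducible φ₂) (iX₀ : SmaleSpace.IsIrreducible φ₀)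
    (η₁ : X → X₁) (η₂ : X → X₂) (π₁ : X₁ → X₀) (π₂ : X₂ → X₀)
    (hη₁ : SmaleSpace.IsFactorMap φ φ₁ η₁) (hη₂ : SmaleSpace.IsFactorMap φ φ₂ η₂)
    (hπ₁ : SmaleSpace.IsFactorMap φ₁ φ₀ π₁) (hπ₂ : SmaleSpace.IsFactorMap φ₂ φ₀ π₂)
    (sη₁ : SmaleSpace.IsSBijective φ φ₁ η₁) (sπ₂ : SmaleSpace.IsSBijective φ₂ φ₀ π₂)
    (uη₂ : SmaleSpace.IsUBijective φ φ₂ η₂) (uπ₁ : SmaleSpace.IsUBijective φ₁ φ₀ π₁)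
    (hcomm : ∀ x, π₂ (η₂ x) = π₁ (η₁ x))
    (honto : Function.Surjective (SmaleSpace.toFibreProduct η₂ η₁ hcomm))
    (hsingle : (∃ z : X₁, ∃ x : X, η₁ ⁻¹' {z} = {x}) ∨ (∃ z : X₂, ∃ x : X, η₂ ⁻¹' {z} = {x})) :
    SmaleSpace.IsConjugacy φ
      (SmaleSpace.fibreProductHomeo φ₂ φ₁ φ₀.toEquiv hπ₂.2.1 hπ₁.2.1)
      (SmaleSpace.toFibreProduct η₂ η₁ hcomm) := by
  have hempty : SmaleSpace.nonInjLocus η₂ η₁ = ∅ := by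
    refine (SmaleSpace.eq_empty_or_univ_of_saturated hX iX ?_ ?_ ?_).resolve_right ?_
    · rintro x ⟨x', h₂, h₁, hne⟩
      exact ⟨φ x', by rw [hη₂.2.1.eq, hη₂.2.1.eq, h₂], by rw [hη₁.2.1.eq, hη₁.2.1.eq, h₁],
        φ.injective.ne hne⟩
    · intro x hx y hy
      exact SmaleSpace.mem_nonInjLocus_of_mem_stableSet hη₂.1 hη₂.2.1 sη₁ sπ₂ hcomm hx hy
    · intro x hx y hy
      -- For the inverse maps, u-bijective reads as s-bijective, so `η₂` and `π₁` now do the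
      -- lifting.
      rw [SmaleSpace.nonInjLocus_swap] at hx ⊢
      exact SmaleSpace.mem_nonInjLocus_of_mem_stableSet (φ := φ.symm) (α := φ₁.symm)
        (β := φ₂.symm) (γ := φ₀.symm) hη₁.1
        (hη₁.2.1.inverses_right φ.right_inv φ₁.left_inv) uη₂ uπ₁ (fun x => (hcomm x).symm) hx hy
    · intro huniv
      obtain ⟨z, x, hx⟩ | ⟨z, x, hx⟩ := hsingle
      all_goals
        obtain ⟨x', h₂, h₁, hne⟩ : x ∈ SmaleSpace.nonInjLocus η₂ η₁ := huniv ▸ Set.mem_univ x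
        have hxz : x ∈ ({x} : Set X) := rfl
        rw [← hx] at hxz
        refine hne (hx.subset (?_ : _ = _))
      exacts [h₁.trans hxz, h₂.trans hxz]
  have hinj : Function.Injective (SmaleSpace.toFibreProduct η₂ η₁ hcomm) := by
    intro x' x h
    by_contra hne
    have h' := congrArg Subtype.val h
    exact Set.eq_empty_iff_forall_notMem.1 hempty x
      ⟨x', congrArg Prod.fst h', congrArg Prod.snd h', hne⟩
  have hcont : Continuous (SmaleSpace.toFibreProduct η₂ η₁ hcomm) :=
    (hη₂.1.prodMk hη₁.1).subtype_mk hcomm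
  refine ⟨isHomeomorph_iff_continuous_bijective.2 ⟨hcont, hinj, honto⟩, fun x => ?_⟩
  exact Subtype.ext (Prod.ext (hη₂.2.1 x) (hη₁.2.1 x))
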